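/- Let $R$ be a commutative ring with identity and let $M$ be a unital $R$-module. For a submodule $N$ of $M$ write $\mathrm{Ann}_R(N)=\{r\in R : rN=0\}$. A submodule $S$ of $M$ is \emph{second} if $S\neq 0$ and for every $r\in R$ either $rS=S$ or $rS=0$; the \emph{socle} $\mathrm{soc}(N)$ of a submodule $N$ is the sum of all second submodules contained in $N$ (and $0$ if there are none). A submodule $K$ of $M$ is \emph{secondary} if $K\neq 0$ and for every $r\in R$ either $rK=K$ or $r^nK=0$ for some positive integer $n$. Let $\mathrm{Spec}^L(M)$ be the set of all secondary submodules $K$ of $M$ with $\mathrm{Ann}_R(\mathrm{soc}(K))=\sqrt{\mathrm{Ann}_R(K)}$, equipped with the Zariski topology, whose closed sets are exactly the sets $\nu^s(N)=\{K\in \mathrm{Spec}^L(M) : \mathrm{Ann}_R(N)\subseteq\sqrt{\mathrm{Ann}_R(K)}\}$, where $N$ runs over the submodules of $M$. For a prime ideal $p$ of $R$ let $\mathrm{Spec}^L_p(M)=\{K\in \mathrm{Spec}^L(M) : \sqrt{\mathrm{Ann}_R(K)}=p\}$. Proposition. Suppose that $\mathrm{Spec}^L(M)$ is finite and non-empty.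 Then $\mathrm{Spec}^L(M)$ is a spectral space (that is, homeomorphic to the prime spectrum of some commutative ring, equipped with the Zariski topology) if and only if $|\mathrm{Spec}^L_p(M)|\leq 1$ for every prime ideal $p$ of $R$. -/

import Mathlib

open scoped Pointwise

universe u v w

section Submodules

variable {R : Type u} {M : Type v} [CommRing R] [AddCommGroup M] [Module R M]

/-- A submodule `S` is second if `S ≠ 0` and for every `r`, `r S = S` or `r S = 0`. -/
def IsSecondSubmodule (S : Submodule R M) : Prop :=
  S ≠ ⊥ ∧ ∀ r : R, r • S = S ∨ r • S = ⊥

/-- A submodule `K` is secondary if `K ≠ 0` and for every `r`, `r K = K` or `r ^ n K = 0` for some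
positive integer `n`. -/
def IsSecondarySubmodule (K : Submodule R M) : Prop :=
  K ≠ ⊥ ∧ ∀ r : R, r • K = K ∨ ∃ n : ℕ, 0 < n ∧ r ^ n • K = ⊥

/-- The (second) socle of a submodule `N`: the sum of all second submodules contained in `N`
(and `0` if there are none). -/
def secondSocle (N : Submodule R M) : Submodule R M :=
  sSup {S : Submodule R M | IsSecondSubmodule S ∧ S ≤ N}

end Submodules

/-- The secondary-like spectrum of `M`: the secondary submodules `K` of `M` such that
`Ann (soc K) = √(Ann K)`. -/
@[ext]
structure SecondaryLikeSpectrum (R : Type u) (M : Type v) [CommRing R] [AddCommGroup M]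
    [Module R M] : Type v where
  carrier : Submodule R M
  secondary : IsSecondarySubmodule carrier
  annihilator_socle : (secondSocle carrier).annihilator = carrier.annihilator.radical

namespace SecondaryLikeSpectrum

variable {R : Type u} {M : Type v} [CommRing R] [AddCommGroup M] [Module R M]

/-- The variety of a submodule `N`: all `K` in the spectrum with `Ann N ⊆ √(Ann K)`. -/
def variety (N : Submodule R M) : Set (SecondaryLikeSpectrum R M) :=
  {K | N.annihilator ≤ K.carrier.annihilator.radical}

/-- The part of the spectrum over an ideal `p`: all `K` in the spectrum with `√(Ann K) = p`. -/
def fiber (M : Type v) [AddCommGroup M] [Module R M] (p : Ideal R) :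
    Set (SecondaryLikeSpectrum R M) :=
  {K | K.carrier.annihilator.radical = p}

theorem smul_eq_bot_iff (r : R) (N : Submodule R M) : r • N = ⊥ ↔ r ∈ N.annihilator := by
  rw [Submodule.mem_annihilator, Submodule.eq_bot_iff]
  constructor
  · intro h n hn
    exact h _ (Submodule.smul_mem_pointwise_smul n r N hn)
  · intro h x hx
    obtain ⟨n, hn, rfl⟩ := (Submodule.mem_smul_pointwise_iff_exists x r N).1 hx
    exact h n hn

theorem radical_isPrime (K : SecondaryLikeSpectrum R M) :
    K.carrier.annihilator.radical.IsPrime := by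
  obtain ⟨N, ⟨hne, hN⟩, _⟩ := K
  change N.annihilator.radical.IsPrime
  refine ⟨?_, ?_⟩
  · intro h
    apply hne
    rw [Ideal.radical_eq_top, Submodule.annihilator_eq_top_iff] at h
    exact h
  · rintro x y ⟨n, hn⟩
    rcases hN x with hx | ⟨m, _, hm⟩
    · right
      refine ⟨n, ?_⟩
      have hxn : x ^ n • N = N := by
        clear hn
        induction n with
        | zero => simp
        | succ k ih => rw [pow_succ, mul_smul, hx, ih]
      rw [← smul_eq_bot_iff, mul_pow, mul_comm, mul_smul, hxn] at hn
      exact (smul_eq_bot_iff _ _).1 hn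
    · left
      exact ⟨m, (smul_eq_bot_iff _ _).1 hm⟩

theorem variety_bot : variety (⊥ : Submodule R M) = ∅ := by
  ext K
  simp only [variety, Set.mem_ofPred_eq, Submodule.annihilator_bot, top_le_iff,
    Set.mem_empty_iff_false, iff_false]
  exact (radical_isPrime K).ne_top

theorem variety_sup (N₁ N₂ : Submodule R M) :
    variety (N₁ ⊔ N₂) = variety N₁ ∪ variety N₂ := by
  ext K
  have h : (N₁ ⊔ N₂).annihilator = N₁.annihilator ⊓ N₂.annihilator := by
    ext r
    simp only [← smul_eq_bot_iff, Submodule.mem_inf, Submodule.smul_sup', sup_eq_bot_iff]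
  simp only [variety, Set.mem_ofPred_eq, Set.mem_union, h]
  exact (radical_isPrime K).inf_le

/-- `Ann_M (Ann_R N)`. -/
def doubleAnnihilator (N : Submodule R M) : Submodule R M :=
  Submodule.torsionBySet R M (N.annihilator : Set R)

theorem sInter_variety (A : Set (Submodule R M)) :
    ⋂ N ∈ A, variety N = variety (⨅ N ∈ A, doubleAnnihilator N) := by
  ext K
  simp only [Set.mem_iInter, variety, Set.mem_ofPred_eq]
  constructor
  · intro h
    rw [← K.annihilator_socle]
    refine Submodule.annihilator_mono (le_iInf₂ fun N hN x hx => ?_)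
    refine (Submodule.mem_torsionBySet_iff _ _).2 fun r => ?_
    have hr := h N hN r.2
    rw [← K.annihilator_socle] at hr
    exact (Submodule.mem_annihilator.1 hr) x hx
  · intro h N hN r hr
    refine h (Submodule.mem_annihilator.2 fun x hx => ?_)
    exact (Submodule.mem_torsionBySet_iff _ _).1 (iInf₂_le (f := fun N (_ : N ∈ A) => doubleAnnihilator N) N hN hx) ⟨r, hr⟩

/-- The Zariski topology on the secondary-like spectrum: the closed sets are exactly the
varieties of the submodules of `M`. -/
instance zariskiTopology : TopologicalSpace (SecondaryLikeSpectrum R M) :=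
  TopologicalSpace.ofClosed (Set.range fun N : Submodule R M => variety N)
    ⟨⊥, variety_bot⟩
    (by
      intro A hA
      refine ⟨⨅ N ∈ {N : Submodule R M | variety N ∈ A}, doubleAnnihilator N, ?_⟩
      change variety _ = _
      rw [← sInter_variety]
      ext K
      simp only [Set.mem_iInter, Set.mem_ofPred_eq, Set.mem_sInter]
      constructor
      · intro h s hs
        obtain ⟨N, rfl⟩ := hA hs
        exact h N hs
      · exact fun h N hN => h _ hN)
    (by
      rintro _ ⟨N₁, rfl⟩ _ ⟨N₂, rfl⟩
      exact ⟨N₁ ⊔ N₂, variety_sup N₁ N₂⟩)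

theorem isClosed_iff (s : Set (SecondaryLikeSpectrum R M)) :
    IsClosed s ↔ ∃ N : Submodule R M, s = variety N := by
  rw [← isOpen_compl_iff]
  change sᶜᶜ ∈ Set.range (fun N : Submodule R M => variety N) ↔ _
  rw [compl_compl, Set.mem_range]
  exact exists_congr fun N => eq_comm

end SecondaryLikeSpectrum

/-- A topological space is spectral if it is homeomorphic to the prime spectrum, with the
Zariski topology, of some commutative ring (in the universe `w`). -/
def IsSpectralSpace (X : Type v) [TopologicalSpace X] : Prop :=
  ∃ (A : Type w) (_ : CommRing A), Nonempty (X ≃ₜ PrimeSpectrum A)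

/-! A prime spectrum is T₀, and here T₀ says exactly that no two points share `√(Ann K)`, since
specialization is inclusion of these radicals. For the converse, a finite T₀ space is a finite poset
under specialization, and it suffices to realize that poset as a prime spectrum. Attach a copy of
ℂ(t) to each point. Along `x < y`, functions at `x` take at `c y` a value in ℂ, which an embedding
`θ` of ℂ(t) into ℂ compares with the function at `y`. Zero sets in the resulting ring are upper
sets, they decide membership in primes, and every prime is the kernel of evaluation at a point. -/

open Polynomial in
/-- The rational function `g` is regular at `c`, with value `v`. -/
def RatFunc.HasValueAt (g : RatFunc ℂ) (c v : ℂ) : Prop :=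
  ∃ p q : ℂ[X], q.eval c ≠ 0 ∧
    g * algebraMap ℂ[X] (RatFunc ℂ) q = algebraMap ℂ[X] (RatFunc ℂ) p ∧ p.eval c = v * q.eval c

namespace RatFunc.HasValueAt

variable {f g : RatFunc ℂ} {c a b : ℂ}

theorem of_polynomial (p : Polynomial ℂ) (c : ℂ) :
    HasValueAt (algebraMap (Polynomial ℂ) (RatFunc ℂ) p) c (p.eval c) :=
  ⟨p, 1, by simp, by simp, by simp⟩

theorem zero (c : ℂ) : HasValueAt 0 c 0 := by simpa using of_polynomial 0 c

theorem one (c : ℂ) : HasValueAt 1 c 1 := by simpa using of_polynomial 1 c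

theorem add (hf : HasValueAt f c a) (hg : HasValueAt g c b) : HasValueAt (f + g) c (a + b) := by
  obtain ⟨p, q, hq, h, hv⟩ := hf
  obtain ⟨p', q', hq', h', hv'⟩ := hg
  refine ⟨p * q' + p' * q, q * q', by simp [hq, hq'], ?_, ?_⟩
  · simp only [map_add, map_mul, ← h, ← h']; ring
  · simp only [Polynomial.eval_add, Polynomial.eval_mul, hv, hv']; ring

theorem mul (hf : HasValueAt f c a) (hg : HasValueAt g c b) : HasValueAt (f * g) c (a * b) := by
  obtain ⟨p, q, hq, h, hv⟩ := hf
  obtain ⟨p', q', hq', h', hv'⟩ := hg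
  refine ⟨p * p', q * q', by simp [hq, hq'], ?_, ?_⟩
  · simp only [map_mul, ← h, ← h']; ring
  · simp only [Polynomial.eval_mul, hv, hv']; ring

theorem neg (hf : HasValueAt f c a) : HasValueAt (-f) c (-a) := by
  obtain ⟨p, q, hq, h, hv⟩ := hf
  exact ⟨-p, q, hq, by simp [← h], by simp [hv]⟩

theorem pow (hf : HasValueAt f c a) (n : ℕ) : HasValueAt (f ^ n) c (a ^ n) := by
  induction n with
  | zero => simpa using one c
  | succ n ih => simpa only [pow_succ] using ih.mul hf

theorem eq_zero (h : HasValueAt 0 c a) : a = 0 := by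
  obtain ⟨p, q, hq, h, hv⟩ := h
  rw [zero_mul, eq_comm, map_eq_zero_iff _ (RatFunc.algebraMap_injective ℂ)] at h
  simpa [h, hq] using hv

theorem inv (hf : HasValueAt f c a) (ha : a ≠ 0) : HasValueAt f⁻¹ c a⁻¹ := by
  obtain ⟨p, q, hq, h, hv⟩ := hf
  have hf0 : f ≠ 0 := by
    rintro rfl
    exact ha (eq_zero ⟨p, q, hq, h, hv⟩)
  refine ⟨q, p, by simp [hv, ha, hq], ?_, ?_⟩
  · rw [← h, inv_mul_cancel_left₀ hf0]
  · rw [hv, inv_mul_cancel_left₀ ha]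

/-- A large power of a function vanishing at `c` absorbs the zero at `c` of any nonzero function. -/
theorem exists_pow_div (hf : HasValueAt f c 0) (hg : g ≠ 0) :
    ∃ k : ℕ, ∀ m, k ≤ m → HasValueAt (f ^ m / g) c 0 := by
  obtain ⟨p, q, hq, h, hv⟩ := hf
  have hp : p.IsRoot c := by simpa using hv
  obtain ⟨p', rfl⟩ := Polynomial.dvd_iff_isRoot.2 hp
  obtain ⟨s, t, ht, rfl⟩ := IsFractionRing.div_surjective (A := Polynomial ℂ) g
  have hs : s ≠ 0 := by rintro rfl; simp at hg
  have ht0 : t ≠ 0 := nonZeroDivisors.ne_zero ht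
  obtain ⟨s', hs', hd⟩ := Polynomial.exists_eq_pow_rootMultiplicity_mul_and_not_dvd s hs c
  set k := s.rootMultiplicity c
  rw [Polynomial.dvd_iff_isRoot, Polynomial.IsRoot.def] at hd
  -- Dividing by `g` costs `k` factors `X - c`; the extra one makes the value 0.
  refine ⟨k + 1, fun m hm => ?_⟩
  obtain ⟨j, rfl⟩ := Nat.exists_eq_add_of_le hm
  have inj := RatFunc.algebraMap_injective ℂ
  have hS := (map_ne_zero_iff _ inj).2 hs
  have hT := (map_ne_zero_iff _ inj).2 ht0
  refine ⟨(Polynomial.X - Polynomial.C c) ^ (j + 1) * p' ^ (k + 1 + j) * t,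
    q ^ (k + 1 + j) * s', by simp [hq, hd], ?_, by simp⟩
  have key : algebraMap (Polynomial ℂ) (RatFunc ℂ)
      ((((Polynomial.X - Polynomial.C c) * p') ^ (k + 1 + j)) * s') =
      algebraMap (Polynomial ℂ) (RatFunc ℂ)
      ((Polynomial.X - Polynomial.C c) ^ (j + 1) * p' ^ (k + 1 + j) * s) := by
    congr 1
    conv_rhs => rw [hs']
    rw [mul_pow]
    ring
  simp only [map_mul, map_pow, ← h] at key ⊢
  field_simp
  linear_combination key

end RatFunc.HasValueAt

/-- The algebraic closure of ℂ(t) has characteristic zero and the cardinality of ℂ, hence is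
isomorphic to ℂ. -/
theorem RatFunc.exists_ringHom_complex : Nonempty (RatFunc ℂ →+* ℂ) := by
  open Cardinal in
  have h1 : #(RatFunc ℂ) = #ℂ := by
    rw [IsFractionRing.cardinalMk (Polynomial ℂ) (RatFunc ℂ), Polynomial.cardinalMk_eq_max]
    exact max_eq_left (aleph0_le_mk ℂ)
  have h2 : #(AlgebraicClosure (RatFunc ℂ)) = #ℂ := by
    refine le_antisymm ?_ ?_
    · refine (Algebra.IsAlgebraic.cardinalMk_le_max (RatFunc ℂ) _).trans ?_
      rw [h1, max_eq_left (aleph0_le_mk ℂ)]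
    · rw [← h1]
      exact mk_le_of_injective (algebraMap (RatFunc ℂ) (AlgebraicClosure (RatFunc ℂ))).injective
  obtain ⟨e⟩ := IsAlgClosed.ringEquiv_of_equiv_of_charZero
    (by rw [h2, Cardinal.mk_complex]; exact Cardinal.aleph0_lt_continuum) (Cardinal.eq.1 h2)
  exact ⟨e.toRingHom.comp (algebraMap _ _)⟩

theorem Polynomial.exists_ne_zero_eval_eq {F ι : Type*} [Field F] [Finite ι] {c : ι → F}
    (hc : Function.Injective c) (r : ι → F) : ∃ p : Polynomial F, p ≠ 0 ∧ ∀ i, p.eval (c i) = r i := by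
  classical
  have := Fintype.ofFinite ι
  refine ⟨Lagrange.interpolate Finset.univ c r + Lagrange.nodal Finset.univ c, fun h => ?_,
    fun i => ?_⟩
  · have := Lagrange.degree_interpolate_lt (s := Finset.univ) r hc.injOn
    rw [eq_neg_of_add_eq_zero_left h, Polynomial.degree_neg, Lagrange.degree_nodal] at this
    exact this.false
  · rw [Polynomial.eval_add, Lagrange.eval_interpolate_at_node r hc.injOn (Finset.mem_univ i),
      Lagrange.eval_nodal_at_node (Finset.mem_univ i), add_zero]

theorem exists_nat_forall_add_mul_ne_zero {F ι : Type*} [Field F] [CharZero F] [Finite ι]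
    (a b : ι → F) : ∃ n : ℕ, ∀ i, b i ≠ 0 → a i + n * b i ≠ 0 := by
  obtain ⟨n, hn⟩ := ((Set.finite_range fun i => -(a i / b i)).preimage
    (Nat.cast_injective (R := F)).injOn).exists_notMem
  refine ⟨n, fun i hb h => hn ⟨i, ?_⟩⟩
  change -(a i / b i) = n
  field_simp
  linear_combination -h

/-! ### A ring whose prime spectrum is a given finite poset -/

section PosetRing

variable {X : Type v} [PartialOrder X] (θ : RatFunc ℂ →+* ℂ) (c : X → ℂ)

/-- The compatible families of rational functions on a poset: for `x < y` the component at `x` is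
regular at the point `c y`, and its value there is the image under `θ` of the component at `y`. -/
def posetRing : Subring (X → RatFunc ℂ) where
  carrier := {f | ∀ ⦃x y⦄, x < y → (f x).HasValueAt (c y) (θ (f y))}
  zero_mem' x y _ := by simpa using RatFunc.HasValueAt.zero (c y)
  one_mem' x y _ := by simpa using RatFunc.HasValueAt.one (c y)
  add_mem' hf hg x y h := by simpa using (hf h).add (hg h)
  mul_mem' hf hg x y h := by simpa using (hf h).mul (hg h)
  neg_mem' hf x y h := by simpa using (hf h).neg

namespace posetRing

variable {θ c}

theorem apply_eq_zero_of_le (f : posetRing θ c) {x y : X} (h : x ≤ y) (hx : f.1 x = 0) :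
    f.1 y = 0 := by
  obtain rfl | h := h.eq_or_lt
  · exact hx
  · have := f.2 h
    rw [hx] at this
    exact (map_eq_zero θ).1 this.eq_zero

/-- Every upper set is the zero set of an element. -/
theorem exists_zeros_eq [Finite X] (hc : Function.Injective c) {U : Set X} (hU : IsUpperSet U) :
    ∃ f : posetRing θ c, ∀ x, f.1 x = 0 ↔ x ∈ U := by
  classical
  choose P hP0 hP using fun r : X → ℂ => Polynomial.exists_ne_zero_eval_eq hc r
  -- Recursion from the maximal points down: off `U`, a nonzero polynomial interpolates the values
  -- prescribed by the points above `x`.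
  let step (x : X) (F : ∀ y, y > x → RatFunc ℂ) : RatFunc ℂ :=
    if x ∈ U then 0 else
      algebraMap _ _ (P fun y => if h : y > x then θ (F y h) else 0)
  have wf : WellFounded ((· > ·) : X → X → Prop) := wellFounded_gt
  let f : X → RatFunc ℂ := wf.fix step
  have hf (x : X) : f x = step x fun y _ => f y := wf.fix_eq step x
  have hf0 (x : X) : f x = 0 ↔ x ∈ U := by
    rw [hf]
    by_cases hx : x ∈ U
    · simp [step, hx]
    · simp only [step, hx, if_false, iff_false]
      exact (map_ne_zero_iff _ (RatFunc.algebraMap_injective ℂ)).2 (hP0 _)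
  refine ⟨⟨f, fun x y hxy => ?_⟩, hf0⟩
  by_cases hx : x ∈ U
  · rw [(hf0 x).2 hx, (hf0 y).2 (hU hxy.le hx), map_zero]
    exact .zero _
  · rw [hf x]
    simp only [step, hx, if_false]
    convert RatFunc.HasValueAt.of_polynomial _ (c y) using 1
    rw [hP, dif_pos hxy]

/-- The quotient `h ^ m / f` is compatible along `x < y`: if `h` vanishes at `y`, a large `m`
absorbs any pole; otherwise `f` is nonzero there and values divide. -/
theorem dvd_pow_of_zeros [Finite X] {f h : posetRing θ c} (hz : ∀ x, f.1 x = 0 → h.1 x = 0) :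
    ∃ n : ℕ, f ∣ h ^ n := by
  have key (z : X × X) : ∃ k : ℕ, z.1 < z.2 → f.1 z.1 ≠ 0 → h.1 z.2 = 0 → ∀ m, k ≤ m →
      RatFunc.HasValueAt (h.1 z.1 ^ m / f.1 z.1) (c z.2) 0 := by
    by_cases H : z.1 < z.2 ∧ f.1 z.1 ≠ 0 ∧ h.1 z.2 = 0
    · have := h.2 H.1
      rw [H.2.2, map_zero] at this
      obtain ⟨k, hk⟩ := this.exists_pow_div H.2.1
      exact ⟨k, fun _ _ _ => hk⟩
    · exact ⟨0, fun h1 h2 h3 => absurd ⟨h1, h2, h3⟩ H⟩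
  choose k hk using key
  obtain ⟨n, hn⟩ := (Set.finite_range k).bddAbove
  have hn' (z) : k z ≤ n + 1 := (hn ⟨z, rfl⟩).trans n.le_succ
  -- Where `f` vanishes, so does `h`, and the convention `a / 0 = 0` gives the right component; the
  -- exponent must be positive there.
  refine ⟨n + 1, ⟨fun x => h.1 x ^ (n + 1) / f.1 x, fun x y hxy => ?_⟩, ?_⟩
  · beta_reduce
    by_cases hx : f.1 x = 0
    · rw [hx, apply_eq_zero_of_le f hxy.le hx]
      simpa using RatFunc.HasValueAt.zero (c y)
    by_cases hy : h.1 y = 0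
    · rw [hy]
      simpa using hk (x, y) hxy hx hy _ (hn' _)
    · have hfy : f.1 y ≠ 0 := fun h0 => hy (hz y h0)
      simpa [div_eq_mul_inv] using ((h.2 hxy).pow (n + 1)).mul
        ((f.2 hxy).inv ((map_ne_zero θ).2 hfy))
  · ext x
    change h.1 x ^ (n + 1) = f.1 x * (h.1 x ^ (n + 1) / f.1 x)
    by_cases hx : f.1 x = 0
    · simp [hx, hz x hx]
    · rw [mul_div_cancel₀ _ hx]

theorem mem_of_zeros [Finite X] {P : Ideal (posetRing θ c)} [P.IsPrime] {f h : posetRing θ c}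
    (hf : f ∈ P) (hz : ∀ x, f.1 x = 0 → h.1 x = 0) : h ∈ P := by
  obtain ⟨n, hn⟩ := dvd_pow_of_zeros hz
  exact Ideal.IsPrime.mem_of_pow_mem ‹_› n (P.mem_of_dvd hn hf)

variable (θ c) in
/-- Evaluation at a point. -/
noncomputable def eval (x : X) : posetRing θ c →+* RatFunc ℂ := (Pi.evalRingHom _ x).comp (posetRing θ c).subtype

variable (θ c) in
/-- The prime of elements vanishing at a point. -/
noncomputable def point (x : X) : PrimeSpectrum (posetRing θ c) :=
  ⟨RingHom.ker (eval θ c x), RingHom.ker_isPrime _⟩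

theorem mem_point {x : X} {f : posetRing θ c} : f ∈ (point θ c x).asIdeal ↔ f.1 x = 0 := Iff.rfl

theorem point_le_point_iff [Finite X] (hc : Function.Injective c) {x y : X} :
    point θ c x ≤ point θ c y ↔ x ≤ y := by
  refine ⟨fun h => ?_, fun h f hf => apply_eq_zero_of_le f h hf⟩
  obtain ⟨f, hf⟩ := exists_zeros_eq (θ := θ) hc (isUpperSet_Ici x)
  exact (hf y).1 (h (mem_point.2 ((hf x).2 le_rfl)))

/-- If the zero set of an element of a prime is a union of principal upper sets, one of the
corresponding points lies below the prime. -/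
theorem exists_point_le [Finite X] (hc : Function.Injective c) (P : PrimeSpectrum (posetRing θ c))
    {f : posetRing θ c} (hf : f ∈ P.asIdeal) : ∃ x, f.1 x = 0 ∧ point θ c x ≤ P := by
  have := Fintype.ofFinite X
  classical
  choose g hg using fun x => exists_zeros_eq (θ := θ) hc (isUpperSet_Ici x)
  -- This product vanishes wherever `f` does, so it lies in `P`, and primality selects a factor.
  have hprod : ∏ x with f.1 x = 0, g x ∈ P.asIdeal := by
    refine mem_of_zeros hf fun x hx => ?_
    change eval θ c x _ = 0
    rw [map_prod]
    exact Finset.prod_eq_zero (i := x) (by simpa using hx) ((hg x x).2 le_rfl)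
  obtain ⟨x, hx, hxP⟩ := (Ideal.IsPrime.prod_mem_iff (hp := P.2)).1 hprod
  refine ⟨x, by simpa using hx, fun h hh => mem_of_zeros hxP fun y hy => ?_⟩
  exact apply_eq_zero_of_le h ((hg x y).1 hy) hh

theorem point_surjective [Finite X] (hc : Function.Injective c) :
    Function.Surjective (point θ c) := by
  intro P
  obtain ⟨x₀, -, hx₀⟩ := exists_point_le hc P (zero_mem _)
  obtain ⟨x, hx, hmax⟩ := (Set.toFinite {x | point θ c x ≤ P}).exists_maximal ⟨x₀, hx₀⟩
  refine ⟨x, le_antisymm hx fun f hf => ?_⟩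
  obtain ⟨g, hg⟩ := exists_zeros_eq (θ := θ) hc (isUpperSet_Ici x)
  -- With this `n`, `f + n g` can vanish only where `g` does, that is above `x`; maximality of `x`
  -- then forces `f` to vanish at `x`.
  obtain ⟨n, hn⟩ := exists_nat_forall_add_mul_ne_zero f.1 g.1
  have hgP : g ∈ P.asIdeal := hx (mem_point.2 ((hg x).2 le_rfl))
  obtain ⟨y, hy, hyP⟩ := exists_point_le hc P
    (P.asIdeal.add_mem hf (P.asIdeal.mul_mem_left (n : posetRing θ c) hgP))
  have hy : f.1 y + n * g.1 y = 0 := by simpa using hy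
  have hgy : g.1 y = 0 := by_contra fun h => hn y h hy
  have hxy : x ≤ y := (hg y).1 hgy
  rw [mem_point, hxy.antisymm (hmax hyP hxy)]
  simpa [hgy] using hy

end posetRing

end PosetRing

theorem exists_equiv_primeSpectrum (X : Type v) [Finite X] [PartialOrder X] :
    ∃ B : Subring (X → RatFunc ℂ), Nonempty (X ≃o PrimeSpectrum B) := by
  obtain ⟨θ⟩ := RatFunc.exists_ringHom_complex
  obtain ⟨n, ⟨e⟩⟩ := Finite.exists_equiv_fin X
  have hc : Function.Injective fun x => ((e x : ℕ) : ℂ) :=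
    Nat.cast_injective.comp (Fin.val_injective.comp e.injective)
  exact ⟨posetRing θ _, ⟨RelIso.ofSurjective
    (OrderEmbedding.ofMapLEIff _ fun _ _ => posetRing.point_le_point_iff hc)
    (posetRing.point_surjective hc)⟩⟩

/-- Every finite `T₀` space is spectral. -/
theorem isSpectralSpace_of_finite (X : Type v) [TopologicalSpace X] [Finite X] [T0Space X] :
    IsSpectralSpace.{v, w} X := by
  let _ : PartialOrder X :=
    { le x y := x ⤳ y
      le_refl x := specializes_refl x
      le_trans _ _ _ h h' := h.trans h'
      le_antisymm _ _ h h' := (h.antisymm h').eq }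
  obtain ⟨B, ⟨e⟩⟩ := exists_equiv_primeSpectrum X
  have : Finite (PrimeSpectrum B) := Finite.of_equiv X e.toEquiv
  have key (x y : X) : e x ⤳ e y ↔ x ⤳ y := by
    rw [← PrimeSpectrum.le_iff_specializes, e.le_iff_le]
    rfl
  refine ⟨Shrink.{w} B, inferInstance, ⟨Homeomorph.trans (Y := PrimeSpectrum B)
    (e.toEquiv.toHomeomorph fun s => ?_)
    (PrimeSpectrum.homeomorphOfRingEquiv (Shrink.ringEquiv.{w} B).symm)⟩⟩
  -- In a finite space specialization determines the open sets.
  rw [isOpen_iff_forall_specializes, isOpen_iff_forall_specializes]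
  simp only [← key, e.surjective.forall]
  rfl

/-! ### Specialization in the secondary-like spectrum -/

namespace SecondaryLikeSpectrum

variable {R : Type u} {M : Type v} [CommRing R] [AddCommGroup M] [Module R M]

theorem specializes_iff {K L : SecondaryLikeSpectrum R M} :
    K ⤳ L ↔ K.carrier.annihilator.radical ≤ L.carrier.annihilator.radical := by
  rw [specializes_iff_forall_closed]
  constructor
  · intro h
    -- As `Ann (soc K) = √(Ann K)`, this variety is the closure of `K`.
    have := h (variety (secondSocle K.carrier)) ((isClosed_iff _).2 ⟨_, rfl⟩)
      K.annihilator_socle.le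
    exact K.annihilator_socle.ge.trans this
  · intro h s hs hK
    obtain ⟨N, rfl⟩ := (isClosed_iff s).1 hs
    exact le_trans (show N.annihilator ≤ _ from hK) h

theorem t0Space_iff : T0Space (SecondaryLikeSpectrum R M) ↔
    ∀ p : Ideal R, p.IsPrime → (fiber M p).encard ≤ 1 := by
  simp only [Set.encard_le_one_iff]
  constructor
  · intro _ p _ K L hK hL
    have hKL := Eq.trans hK (Eq.symm hL)
    exact (specializes_iff.2 hKL.le).antisymm (specializes_iff.2 hKL.ge) |>.eq
  · refine fun h => ⟨fun K L hKL => h _ (radical_isPrime K) K L rfl ?_⟩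
    exact le_antisymm (specializes_iff.1 hKL.specializes') (specializes_iff.1 hKL.specializes)

end SecondaryLikeSpectrum

theorem mainTheorem10 (R : Type u) (M : Type v) [CommRing R] [AddCommGroup M] [Module R M]
    [Finite (SecondaryLikeSpectrum R M)] [Nonempty (SecondaryLikeSpectrum R M)] :
    IsSpectralSpace.{v, w} (SecondaryLikeSpectrum R M) ↔
      ∀ p : Ideal R, p.IsPrime →
        (SecondaryLikeSpectrum.fiber M p).encard ≤ 1 := by
  rw [← SecondaryLikeSpectrum.t0Space_iff]
  refine ⟨?_, fun _ => isSpectralSpace_of_finite _⟩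
  rintro ⟨A, _, ⟨e⟩⟩
  exact e.symm.t0Space
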